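/- Let $\Sigma=\{1,\dots,N\}$ and $A_1,\dots,A_N\in\mathbb{R}^{n\times n}$, and consider the switching linear system $x(t+1)=A_{\sigma(t)}x(t)$, $\sigma:\mathbb{Z}\to\Sigma$. A quadratic $p$-cone is a set $\mathcal{K}(P)=\{x\in\mathbb{R}^n : x^\top Px\le 0\}$, where $P$ is a symmetric matrix with $p$ negative, no zero, and $n-p$ positive eigenvalues (counted with multiplicity). A finite-state automaton consists of a finite set $Q$ of states and a set $\delta\subseteq Q\times\Sigma\times Q$ of transitions; a word $\sigma:\mathbb{Z}\to\Sigma$ is admissible if there is $(q_t)_{t\in\mathbb{Z}}$ in $Q$ with $(q_t,\sigma(t),q_{t+1})\in\delta$ for all $t$. The system is path-complete $p$-dominant for a language $\mathcal{L}\subseteq\Sigma^{\mathbb{Z}}$ if there are a finite-state automaton for which every word of $\mathcal{L}$ is admissible and quadratic $p$-cones $\mathcal{K}(P_q)$, $q\in Q$, such that $A_a\big(\mathcal{K}(P_{q_1})\setminus\{0\}\big)\subseteq\operatorname{int}\mathcal{K}(P_{q_2})$ for every transition $(q_1,a,q_2)\in\delta$. For $s\le t$ write $A_{\sigma(s,t-1)}=A_{\sigma(t-1)}\cdots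 A_{\sigma(s+1)}A_{\sigma(s)}$ (the identity if $s=t$). **Theorem (Dominated splitting).** Suppose that the system is path-complete $p$-dominant for $\mathcal{L}$. Then for every $\sigma\in\mathcal{L}$ there is exactly one pair of collections $\mathcal{H}=(H(t))_{t\in\mathbb{Z}}$, $\mathcal{V}=(V(t))_{t\in\mathbb{Z}}$ of linear subspaces of $\mathbb{R}^n$ with the following properties: 1. $\mathbb{R}^n=H(t)\oplus V(t)$, $\dim H(t)=p$ and $\dim V(t)=n-p$ for every $t\in\mathbb{Z}$; 2. $A_{\sigma(t)}H(t)\subseteq H(t+1)$ and $A_{\sigma(t)}V(t)\subseteq V(t+1)$ for every $t\in\mathbb{Z}$; 3. there are constants $C\ge 1$ and $0<\rho<1$ such that, with $\bar H(t)$ the projection on $H(t)$ along $V(t)$ and $\bar V(t)$ the projection on $V(t)$ along $H(t)$, for all integers $s\le t$ and all $x\in\mathbb{R}^n$ with $\bar H(s)x\ne 0$, $$\frac{|\bar V(t)A_{\sigma(s,t-1)}x|}{|\bar H(t)A_{\sigma(s,t-1)}x|}\le C\rho^{\,t-s}\,\frac{|\bar V(s)x|}{|\bar H(s)x|},$$ where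 the denominator on the left-hand side is nonzero if $p<n$. (If $p=n$, then $\bar V\equiv 0$, and the quotient on the left-hand side is read as $0$ when its denominator vanishes.) The collections and the constants may depend on $\sigma$. -/

import Mathlib

open Matrix

/-- The state space `ℝⁿ` with its Euclidean norm. -/
abbrev StateSpace (n : ℕ) : Type := EuclideanSpace ℝ (Fin n)

/-- The symmetric matrix `P` has inertia `(i, j, k)`: counted with multiplicity, it has `i` negative,
`j` zero and `k` positive eigenvalues. -/
def HasInertia {n : ℕ} (P : Matrix (Fin n) (Fin n) ℝ) (i j k : ℕ) : Prop :=
  ∃ hP : P.IsHermitian,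
    (Finset.univ.filter (fun a => hP.eigenvalues a < 0)).card = i ∧
    (Finset.univ.filter (fun a => hP.eigenvalues a = 0)).card = j ∧
    (Finset.univ.filter (fun a => 0 < hP.eigenvalues a)).card = k

/-- The quadratic cone `𝒦(P) = {x : xᵀ P x ≤ 0}`. -/
def quadCone {n : ℕ} (P : Matrix (Fin n) (Fin n) ℝ) : Set (StateSpace n) :=
  {x | x.ofLp ⬝ᵥ (P *ᵥ x.ofLp) ≤ 0}

/-- A (finite-state, when `Q` is finite) automaton with states `Q`, alphabet `S`, and set of
admissible transitions `δ ⊆ Q × S × Q`. -/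
structure SwitchAutomaton (Q S : Type) where
  /-- the admissible transitions -/
  δ : Set (Q × S × Q)

/-- A bi-infinite word `σ` is admissible for the automaton. -/
def SwitchAutomaton.Admissible {Q S : Type} (M : SwitchAutomaton Q S) (σ : ℤ → S) : Prop :=
  ∃ q : ℤ → Q, ∀ t : ℤ, (q t, σ t, q (t + 1)) ∈ M.δ

/-- The automaton is path-complete for the language `L`. -/
def SwitchAutomaton.PathComplete {Q S : Type} (M : SwitchAutomaton Q S) (L : Set (ℤ → S)) : Prop :=
  ∀ σ ∈ L, M.Admissible σ

/-- The switching system `x(t+1) = A_{σ(t)} x(t)` is `p`-dominant with respect to the automaton: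
there are quadratic `p`-cones `𝒦(P_q)`, `q ∈ Q`, such that `A_s` maps `𝒦(P_{q₁}) ∖ {0}` into the
interior of `𝒦(P_{q₂})` for every admissible transition `(q₁, s, q₂)`. -/
def DominantWrt {n N : ℕ} {Q : Type} (A : Fin N → Matrix (Fin n) (Fin n) ℝ) (p : ℕ)
    (M : SwitchAutomaton Q (Fin N)) : Prop :=
  ∃ P : Q → Matrix (Fin n) (Fin n) ℝ,
    (∀ q, HasInertia (P q) p 0 (n - p)) ∧
    ∀ q₁ s q₂, (q₁, s, q₂) ∈ M.δ →
      Matrix.toEuclideanLin (A s) '' (quadCone (P q₁) \ {0}) ⊆ interior (quadCone (P q₂))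

/-- The switching system is path-complete `p`-dominant for the language `L`. -/
def PathCompleteDominant {n N : ℕ} (A : Fin N → Matrix (Fin n) (Fin n) ℝ) (p : ℕ)
    (L : Set (ℤ → Fin N)) : Prop :=
  ∃ (Q : Type) (_ : Finite Q) (M : SwitchAutomaton Q (Fin N)),
    M.PathComplete L ∧ DominantWrt A p M

/-- `A_{σ(s+k-1)} ⋯ A_{σ(s+1)} A_{σ(s)}`, the product of the `k` matrices starting at time `s`. -/
def stepProduct {n N : ℕ} (A : Fin N → Matrix (Fin n) (Fin n) ℝ) (σ : ℤ → Fin N) (s : ℤ) :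
    ℕ → Matrix (Fin n) (Fin n) ℝ
  | 0 => 1
  | k + 1 => A (σ (s + k)) * stepProduct A σ s k

/-- For `s ≤ t`, the linear map `A_{σ(t-1)} ⋯ A_{σ(s+1)} A_{σ(s)}` that carries `x(s)` to `x(t)`
along every trajectory with switching signal `σ` (the identity when `s = t`). It is only used for
`s ≤ t`. -/
noncomputable def transitionMap {n N : ℕ} (A : Fin N → Matrix (Fin n) (Fin n) ℝ) (σ : ℤ → Fin N)
    (s t : ℤ) : StateSpace n →ₗ[ℝ] StateSpace n :=
  Matrix.toEuclideanLin (stepProduct A σ s (t - s).toNat)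

/-- A collection of subspaces indexed by time. -/
abbrev SubspaceCollection (n : ℕ) : Type := ℤ → Submodule ℝ (StateSpace n)

/-- `H` and `V` are paired: `ℝⁿ = H(t) ⊕ V(t)` for every `t`. -/
def Paired {n : ℕ} (H V : SubspaceCollection n) : Prop := ∀ t, IsCompl (H t) (V t)

/-- The collection has dimension `d`. -/
def OfDim {n : ℕ} (H : SubspaceCollection n) (d : ℕ) : Prop := ∀ t, Module.finrank ℝ (H t) = d

/-- The collection is forward invariant for the switching signal `σ`. -/
def ForwardInvariant {n N : ℕ} (A : Fin N → Matrix (Fin n) (Fin n) ℝ) (σ : ℤ → Fin N)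
    (H : SubspaceCollection n) : Prop :=
  ∀ t : ℤ, (H t).map (Matrix.toEuclideanLin (A (σ t))) ≤ H (t + 1)

/-- For paired collections, the projection on `H(t)` along `V(t)`, as a map into `ℝⁿ`. -/
noncomputable def Paired.projH {n : ℕ} {H V : SubspaceCollection n} (h : Paired H V) (t : ℤ) :
    StateSpace n →ₗ[ℝ] StateSpace n :=
  (H t).projection (V t) (h t)

/-- For paired collections, the projection on `V(t)` along `H(t)`, as a map into `ℝⁿ`. -/
noncomputable def Paired.projV {n : ℕ} {H V : SubspaceCollection n} (h : Paired H V) (t : ℤ) :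
    StateSpace n →ₗ[ℝ] StateSpace n :=
  (V t).projection (H t) (h t).symm

/-- The growth inequality
`|V̄(t) Φ x| / |H̄(t) Φ x| ≤ C ρ^(t-s) |V̄(s) x| / |H̄(s) x|`, `Φ = A_{σ(t-1)} ⋯ A_{σ(s)}`, for all
`s ≤ t` and all `x` for which the right-hand side is a real number. The left-hand denominator is
part of the claim: it does not vanish, except possibly in the degenerate case `V(t) = {0}`, where
the left-hand numerator is identically zero. (If `H̄(s) x = 0` and `x ≠ 0`, the right-hand side
is `+∞` and nothing is claimed.) -/
def RelativeGrowthBound {n N : ℕ} (A : Fin N → Matrix (Fin n) (Fin n) ℝ) (σ : ℤ → Fin N)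
    {H V : SubspaceCollection n} (h : Paired H V) (C ρ : ℝ) : Prop :=
  ∀ s t : ℤ, s ≤ t → ∀ x : StateSpace n, h.projH s x ≠ 0 →
    (V t ≠ ⊥ → h.projH t (transitionMap A σ s t x) ≠ 0) ∧
    ‖h.projV t (transitionMap A σ s t x)‖ / ‖h.projH t (transitionMap A σ s t x)‖ ≤
      C * ρ ^ (t - s) * (‖h.projV s x‖ / ‖h.projH s x‖)

/-- `(H, V)` is a dominated splitting of index `p` along the switching signal `σ`. -/
structure IsDominatedSplitting {n N : ℕ} (A : Fin N → Matrix (Fin n) (Fin n) ℝ) (σ : ℤ → Fin N)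
    (p : ℕ) (H V : SubspaceCollection n) : Prop where
  paired : Paired H V
  dim_H : OfDim H p
  dim_V : OfDim V (n - p)
  invariant_H : ForwardInvariant A σ H
  invariant_V : ForwardInvariant A σ V
  dominated : ∃ C ρ : ℝ, 1 ≤ C ∧ 0 < ρ ∧ ρ < 1 ∧ RelativeGrowthBound A σ paired C ρ

/-!
The argument rests on replacing the cone conditions by a decrease of quadratic forms. Write
`Q_t(x) = ⟪P_{q(t)} x, x⟫` for the forms along an admissible state sequence `q`. If `0 < p < n`, a
strict S-lemma (`exists_multiplier`) applied to each of the finitely many transitions shows that,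
after multiplying the map at each time by a positive scalar, which changes neither invariance nor
domination, the maps `T_t` satisfy `Q_{t+1}(T_t x) ≤ Q_t(x) - ε ‖x‖ ^ 2` with `ε > 0` independent of
`t` (`ContractingForms`, `exists_contractingForms`).

The splitting then consists of `V(t)`, the points with a bounded forward orbit, and `H(t)`, the
points with a bounded backward orbit; no invertibility is needed. On a forward orbit a negative
value of `Q` would be amplified exponentially, so `Q_t(x) ≥ ε ‖x‖ ^ 2` on `V(t)`, and similarly
`Q_t ≤ 0` on `H(t)`; hence the two spaces are disjoint. They are large enough because bounded orbit
pieces of every finite length start from subspaces of dimensions `n - p` and `p`, and orthonormal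
frames of such pieces form compact sets (`le_finrank_boundedStart`). On `V` the form `Q` decays
geometrically, while vectors with `Q ≤ 0` are never contracted below a fixed factor, which gives
domination.

For uniqueness, let `(H', V')` be another dominated splitting. A vector with bounded forward orbit
has no component in `H'`, since the orbit of that component would outgrow the component in `V'` and
therefore be bounded itself, which then would bound all orbits in `V'` (`eq_boundedForward`). So
`V' = V`. A vector `x ∈ H'(t)` is the image of vectors `y_k ∈ H'(t - k)`, and domination of `V'` by
`H'` makes the image of the `V`-component of `y_k` exponentially small in `k` relative to `x`; here
the components of `y_k` are controlled by the uniform angle between `H` and `V`, although nothing is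
known about the angle between `H'` and `V'`. So the `V`-component of `x` vanishes
(`eq_boundedBackward`).

The extreme cases `p = 0` and `p = n`, where the cones are `{0}` and the whole space, are trivial.
-/

/-! ### Evolution of a sequence of linear maps -/

section Evolution

variable {E : Type*} [AddCommGroup E] [Module ℝ E]

/-- The composition `T (s + k - 1) ∘ ⋯ ∘ T (s + 1) ∘ T s` of `k` maps starting at time `s`. -/
def evolution (T : ℤ → E →ₗ[ℝ] E) (s : ℤ) : ℕ → E →ₗ[ℝ] E
  | 0 => LinearMap.id
  | k + 1 => T (s + k) ∘ₗ evolution T s k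

@[simp]
lemma evolution_zero_apply (T : ℤ → E →ₗ[ℝ] E) (s : ℤ) (x : E) : evolution T s 0 x = x := rfl

lemma evolution_succ_apply (T : ℤ → E →ₗ[ℝ] E) (s : ℤ) (k : ℕ) (x : E) :
    evolution T s (k + 1) x = T (s + k) (evolution T s k x) := rfl

lemma evolution_add_apply (T : ℤ → E →ₗ[ℝ] E) (s : ℤ) (j k : ℕ) (x : E) :
    evolution T s (j + k) x = evolution T (s + j) k (evolution T s j x) := by
  induction k with
  | zero => simp
  | succ k ih =>
    rw [← add_assoc, evolution_succ_apply, evolution_succ_apply, ih]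
    congr 2
    push_cast
    ring

lemma evolution_mem {T : ℤ → E →ₗ[ℝ] E} {H : ℤ → Submodule ℝ E}
    (hH : ∀ t, (H t).map (T t) ≤ H (t + 1)) (s : ℤ) (k : ℕ) {x : E} (hx : x ∈ H s) :
    evolution T s k x ∈ H (s + k) := by
  induction k with
  | zero => simpa using hx
  | succ k ih =>
    have := hH _ (Submodule.mem_map_of_mem ih)
    rw [evolution_succ_apply]
    convert this using 2
    push_cast
    ring

end Evolution

/-! ### Bounded histories of sequences of linear relations -/

section BoundedStart

variable {E : Type*} [NormedAddCommGroup E] [InnerProductSpace ℝ E]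

/-- The starting points `w 0` of the bounded sequences `w` whose consecutive terms are related by
the linear relations `R j ⊆ E × E`. For graphs of linear maps these are the points with a bounded
forward orbit, for transposed graphs the points with a bounded backward orbit. -/
def boundedStart (R : ℕ → Submodule ℝ (E × E)) : Submodule ℝ E where
  carrier := {x | ∃ w : ℕ → E, w 0 = x ∧ (∀ j, (w j, w (j + 1)) ∈ R j) ∧ ∃ C, ∀ j, ‖w j‖ ≤ C}
  zero_mem' := ⟨fun _ => 0, rfl, fun j => (R j).zero_mem, 0, by simp⟩
  add_mem' := by
    rintro x y ⟨w, rfl, hw, C, hC⟩ ⟨z, rfl, hz, D, hD⟩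
    exact ⟨w + z, rfl, fun j => (R j).add_mem (hw j) (hz j), C + D,
      fun j => (norm_add_le _ _).trans (add_le_add (hC j) (hD j))⟩
  smul_mem' := by
    rintro c x ⟨w, rfl, hw, C, hC⟩
    refine ⟨c • w, rfl, fun j => (R j).smul_mem c (hw j), |c| * C, fun j => ?_⟩
    rw [Pi.smul_apply, norm_smul, Real.norm_eq_abs]
    exact mul_le_mul_of_nonneg_left (hC j) (abs_nonneg c)

variable [FiniteDimensional ℝ E]

lemma exists_orthonormal_of_le_finrank {m : ℕ} (U : Submodule ℝ E)
    (hU : m ≤ Module.finrank ℝ U) : ∃ v : Fin m → E, Orthonormal ℝ v ∧ ∀ i, v i ∈ U := by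
  let b := stdOrthonormalBasis ℝ U
  refine ⟨fun i => (b (Fin.castLE hU i) : E), ?_, fun i => (b _).2⟩
  exact (b.orthonormal.comp_linearIsometry U.subtypeₗᵢ).comp _ (Fin.castLE_injective hU)

/-- If for every `k` there is an at least `m`-dimensional space of points having a history of
length `k`, with bounds independent of `k`, then the points with an infinite bounded history form a
space of dimension at least `m`: orthonormal `m`-frames together with their bounded histories form
a decreasing sequence of nonempty closed subsets of a product of compact balls. -/
theorem le_finrank_boundedStart (R : ℕ → Submodule ℝ (E × E)) (m : ℕ) (K : ℝ)
    (h : ∀ k : ℕ, ∃ U : Submodule ℝ E, m ≤ Module.finrank ℝ U ∧ ∀ x ∈ U, ∃ w : ℕ → E,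
      w 0 = x ∧ (∀ j < k, (w j, w (j + 1)) ∈ R j) ∧ ∀ j, ‖w j‖ ≤ K * ‖x‖) :
    m ≤ Module.finrank ℝ (boundedStart R) := by
  let F : ℕ → Set (ℕ → Fin m → E) := fun k =>
    {w | (∀ j i, ‖w j i‖ ≤ K) ∧ (∀ i i', inner ℝ (w 0 i) (w 0 i') = if i = i' then (1 : ℝ) else 0) ∧
      ∀ j < k, ∀ i, (w j i, w (j + 1) i) ∈ R j}
  have hclosed : ∀ k, IsClosed (F k) := by
    intro k
    have hF : F k = (⋂ j, ⋂ i, {w | ‖w j i‖ ≤ K}) ∩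
        ((⋂ i, ⋂ i', {w | inner ℝ (w 0 i) (w 0 i') = if i = i' then (1 : ℝ) else 0}) ∩
          ⋂ j, ⋂ (_ : j < k), ⋂ i, {w | (w j i, w (j + 1) i) ∈ R j}) := by
      ext w
      simp [F]
    rw [hF]
    refine IsClosed.inter ?_ (IsClosed.inter ?_ ?_)
    · exact isClosed_iInter fun j => isClosed_iInter fun i =>
        isClosed_le (by fun_prop) continuous_const
    · exact isClosed_iInter fun i => isClosed_iInter fun i' =>
        isClosed_eq (by fun_prop) continuous_const
    · exact isClosed_iInter fun j => isClosed_iInter fun _ => isClosed_iInter fun i =>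
        (Submodule.closed_of_finiteDimensional (R j)).preimage
          (f := fun w : ℕ → Fin m → E => (w j i, w (j + 1) i)) (by fun_prop)
  have hcompact : IsCompact (F 0) := by
    have hc : IsCompact (Set.pi Set.univ fun _ : ℕ => Set.pi Set.univ fun _ : Fin m =>
        Metric.closedBall (0 : E) K) :=
      isCompact_univ_pi fun _ => isCompact_univ_pi fun _ => isCompact_closedBall _ _
    refine hc.of_isClosed_subset (hclosed 0) fun w hw j _ i _ => ?_
    simpa using hw.1 j i
  have hne : ∀ k, (F k).Nonempty := by
    intro k
    obtain ⟨U, hU, hw⟩ := h k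
    obtain ⟨v, hv, hvU⟩ := exists_orthonormal_of_le_finrank U hU
    choose w hw0 hwR hwK using fun i => hw (v i) (hvU i)
    refine ⟨fun j i => w i j, fun j i => ?_, fun i i' => ?_, fun j hj i => hwR i j hj⟩
    · simpa [hv.1 i] using hwK i j
    · simp only [hw0]
      exact orthonormal_iff_ite.1 hv i i'
  obtain ⟨w, hw⟩ := IsCompact.nonempty_iInter_of_sequence_nonempty_isCompact_isClosed F
    (fun k w hw => ⟨hw.1, hw.2.1, fun j hj => hw.2.2 j (by omega)⟩) hne hcompact hclosed
  rw [Set.mem_iInter] at hw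
  have hmem : ∀ i, w 0 i ∈ boundedStart R := fun i =>
    ⟨fun j => w j i, rfl, fun j => (hw (j + 1)).2.2 j (by omega) i, K, fun j => (hw 0).1 j i⟩
  have hon : Orthonormal ℝ (w 0) := orthonormal_iff_ite.2 (hw 0).2.1
  have hli : LinearIndependent ℝ fun i => (⟨w 0 i, hmem i⟩ : boundedStart R) :=
    LinearIndependent.of_comp (boundedStart R).subtype hon.linearIndependent
  simpa using hli.fintype_card_le_finrank

end BoundedStart

/-! ### Bounded orbits and decreasing quadratic forms -/

/-- A negative `a 0` would be amplified exponentially. -/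
lemma nonneg_of_le_one_add_mul {a : ℕ → ℝ} {κ b : ℝ} (hκ : 0 < κ)
    (ha : ∀ j, a (j + 1) ≤ (1 + κ) * a j) (hb : ∀ j, b ≤ a j) : 0 ≤ a 0 := by
  by_contra! h0
  have hpow : ∀ j, a j ≤ (1 + κ) ^ j * a 0 := by
    intro j
    induction j with
    | zero => simp
    | succ j ih =>
      calc a (j + 1) ≤ (1 + κ) * a j := ha j
        _ ≤ (1 + κ) * ((1 + κ) ^ j * a 0) := by gcongr
        _ = _ := by ring
  obtain ⟨k, hk⟩ := pow_unbounded_of_one_lt (b / a 0) (by linarith : 1 < 1 + κ)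
  have h1 := (div_lt_iff_of_neg h0).1 hk
  linarith [hpow k, hb k]

section ContractingForms

variable {E : Type*} [NormedAddCommGroup E] [InnerProductSpace ℝ E]

/-- The quadratic forms `x ↦ ⟪S t x, x⟫` are uniformly bounded, decrease by at least `ε ‖x‖ ^ 2` in
each step along the evolution of `T`, and each of them is nonpositive on a subspace of dimension at
least `p` and nonnegative on a subspace of codimension at most `p`. The requirement `ε < M` is no
restriction, as `M` may be enlarged; it makes the rate `1 - ε / M` positive. -/
structure ContractingForms (T S : ℤ → E →ₗ[ℝ] E) (M ε : ℝ) (p : ℕ) : Prop where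
  symm : ∀ t x y, inner ℝ (S t x) y = inner ℝ x (S t y)
  bound : ∀ t x, ‖S t x‖ ≤ M * ‖x‖
  pos : 0 < ε
  lt : ε < M
  drop : ∀ t x, inner ℝ (S (t + 1) (T t x)) (T t x) ≤ inner ℝ (S t x) x - ε * ‖x‖ ^ 2
  neg_space : ∀ t, ∃ U : Submodule ℝ E, p ≤ Module.finrank ℝ U ∧ ∀ x ∈ U, inner ℝ (S t x) x ≤ 0
  pos_space : ∀ t, ∃ U : Submodule ℝ E, Module.finrank ℝ E ≤ p + Module.finrank ℝ U ∧
    ∀ x ∈ U, 0 ≤ inner ℝ (S t x) x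

/-- The points at time `t` with a bounded forward orbit. -/
def boundedForward (T : ℤ → E →ₗ[ℝ] E) (t : ℤ) : Submodule ℝ E :=
  boundedStart fun j => (T (t + j)).graph

/-- The points at time `t` with a bounded backward orbit. -/
def boundedBackward (T : ℤ → E →ₗ[ℝ] E) (t : ℤ) : Submodule ℝ E :=
  boundedStart fun j => ((T (t - j - 1)).graph).comap
    ((LinearMap.snd ℝ E E).prod (LinearMap.fst ℝ E E))

lemma mem_boundedForward {T : ℤ → E →ₗ[ℝ] E} {t : ℤ} {x : E} :
    x ∈ boundedForward T t ↔ ∃ C, ∀ k, ‖evolution T t k x‖ ≤ C := by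
  constructor
  · rintro ⟨w, rfl, hw, C, hC⟩
    have : ∀ k, evolution T t k (w 0) = w k := by
      intro k
      induction k with
      | zero => rfl
      | succ k ih =>
        rw [evolution_succ_apply, ih]
        exact (LinearMap.mem_graph_iff _ _).1 (hw k) |>.symm
    exact ⟨C, fun k => this k ▸ hC k⟩
  · rintro ⟨C, hC⟩
    exact ⟨fun k => evolution T t k x, rfl, fun j => (LinearMap.mem_graph_iff _ _).2 rfl, C, hC⟩

lemma mem_boundedBackward {T : ℤ → E →ₗ[ℝ] E} {t : ℤ} {x : E} :
    x ∈ boundedBackward T t ↔ ∃ w : ℕ → E, w 0 = x ∧ (∀ j : ℕ, T (t - j - 1) (w (j + 1)) = w j) ∧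
      ∃ C, ∀ j, ‖w j‖ ≤ C := by
  constructor
  · rintro ⟨w, rfl, hw, hC⟩
    exact ⟨w, rfl, fun j => ((LinearMap.mem_graph_iff _ _).1 (hw j)).symm, hC⟩
  · rintro ⟨w, rfl, hw, hC⟩
    exact ⟨w, rfl, fun j => (LinearMap.mem_graph_iff _ _).2 (hw j).symm, hC⟩

lemma map_boundedForward_le (T : ℤ → E →ₗ[ℝ] E) (t : ℤ) :
    (boundedForward T t).map (T t) ≤ boundedForward T (t + 1) := by
  rintro _ ⟨x, hx, rfl⟩
  obtain ⟨C, hC⟩ := mem_boundedForward.1 hx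
  refine mem_boundedForward.2 ⟨C, fun k => ?_⟩
  have := evolution_add_apply T t 1 k x
  simp only [Nat.cast_one, evolution_succ_apply, evolution_zero_apply, Nat.cast_zero,
    add_zero] at this
  rw [← this]
  exact hC _

lemma map_boundedBackward_le (T : ℤ → E →ₗ[ℝ] E) (t : ℤ) :
    (boundedBackward T t).map (T t) ≤ boundedBackward T (t + 1) := by
  rintro _ ⟨x, hx, rfl⟩
  obtain ⟨w, rfl, hw, C, hC⟩ := mem_boundedBackward.1 hx
  refine mem_boundedBackward.2 ⟨fun j => Nat.casesOn j (T t (w 0)) w, rfl, fun j => ?_,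
    max ‖T t (w 0)‖ C, fun j => ?_⟩
  · cases j with
    | zero => simp
    | succ j =>
      rw [show t + 1 - ((j + 1 : ℕ) : ℤ) - 1 = t - j - 1 by push_cast; ring]
      exact hw j
  · cases j with
    | zero => exact le_max_left _ _
    | succ j => exact (hC j).trans (le_max_right _ _)

namespace ContractingForms

variable {T S : ℤ → E →ₗ[ℝ] E} {M ε : ℝ} {p : ℕ}

lemma M_pos (h : ContractingForms T S M ε p) : 0 < M := h.pos.trans h.lt

lemma abs_form_le (h : ContractingForms T S M ε p) (t : ℤ) (x : E) :
    |inner ℝ (S t x) x| ≤ M * ‖x‖ ^ 2 :=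
  calc |inner ℝ (S t x) x| ≤ ‖S t x‖ * ‖x‖ := abs_real_inner_le_norm _ _
    _ ≤ M * ‖x‖ * ‖x‖ := by gcongr; exact h.bound t x
    _ = _ := by ring

lemma form_evolution_le (h : ContractingForms T S M ε p) (s : ℤ) (k : ℕ) (x : E) :
    inner ℝ (S (s + k) (evolution T s k x)) (evolution T s k x) ≤ inner ℝ (S s x) x := by
  induction k with
  | zero => simp
  | succ k ih =>
    have := h.drop (s + k) (evolution T s k x)
    rw [evolution_succ_apply, show s + ((k + 1 : ℕ) : ℤ) = s + k + 1 by push_cast; ring]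
    have := mul_nonneg h.pos.le (sq_nonneg ‖evolution T s k x‖)
    linarith

/-- Vectors on which the form is nonpositive are not contracted by more than a constant factor. -/
lemma norm_sq_le_evolution (h : ContractingForms T S M ε p) (s : ℤ) (k : ℕ) {x : E}
    (hx : inner ℝ (S s x) x ≤ 0) : ε * ‖x‖ ^ 2 ≤ M * ‖evolution T s k x‖ ^ 2 := by
  cases k with
  | zero =>
    simp only [evolution_zero_apply]
    gcongr
    exact h.lt.le
  | succ k =>
    have h1 := h.drop s x
    have h2 := h.form_evolution_le (s + 1) k (T s x)
    have h3 := evolution_add_apply T s 1 k x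
    rw [show evolution T s 1 x = T s x by simp [evolution_succ_apply]] at h3
    rw [add_comm k 1, h3]
    have h4 := (abs_le.1 (h.abs_form_le (s + 1 + k) (evolution T (s + 1) k (T s x)))).1
    push_cast
    linarith

/-- If the form is still nonnegative at time `k + 1`, then the orbit is bounded up to time `k` by a
multiple of the starting vector: the form has only decreased on the way, and it was at least
`ε ‖x‖ ^ 2` one step earlier. -/
lemma evolution_norm_sq_le (h : ContractingForms T S M ε p) (s : ℤ) (k : ℕ) {x : E}
    (hx : 0 ≤ inner ℝ (S (s + (k + 1 : ℕ)) (evolution T s (k + 1) x)) (evolution T s (k + 1) x)) :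
    ε * ‖evolution T s k x‖ ^ 2 ≤ M * ‖x‖ ^ 2 := by
  have h1 := h.drop (s + k) (evolution T s k x)
  rw [evolution_succ_apply, show s + ((k + 1 : ℕ) : ℤ) = s + k + 1 by push_cast; ring] at hx
  have h2 := h.form_evolution_le s k x
  have h3 := (abs_le.1 (h.abs_form_le s x)).2
  linarith

/-- Once negative along a forward orbit, the form would grow exponentially in absolute value. -/
lemma form_nonneg_of_mem_boundedForward (h : ContractingForms T S M ε p) {t : ℤ} {x : E}
    (hx : x ∈ boundedForward T t) : 0 ≤ inner ℝ (S t x) x := by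
  obtain ⟨C, hC⟩ := mem_boundedForward.1 hx
  let a : ℕ → ℝ := fun k => inner ℝ (S (t + k) (evolution T t k x)) (evolution T t k x)
  have hM := h.M_pos
  have ha0 : a 0 = inner ℝ (S t x) x := by simp [a]
  rw [← ha0]
  refine nonneg_of_le_one_add_mul (κ := ε / M) (b := -(M * C ^ 2)) (div_pos h.pos hM)
    (fun j => ?_) (fun j => ?_)
  · have h1 : a (j + 1) ≤ a j - ε * ‖evolution T t j x‖ ^ 2 := by
      have := h.drop (t + j) (evolution T t j x)
      simp only [a]
      rwa [show t + ((j + 1 : ℕ) : ℤ) = t + j + 1 by push_cast; ring]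
    have h2 : -a j ≤ M * ‖evolution T t j x‖ ^ 2 := by
      have := (abs_le.1 (h.abs_form_le (t + j) (evolution T t j x))).1
      simp only [a]
      linarith
    have h3 : ε / M * (-a j) ≤ ε / M * (M * ‖evolution T t j x‖ ^ 2) :=
      mul_le_mul_of_nonneg_left h2 (div_pos h.pos hM).le
    rw [← mul_assoc, div_mul_cancel₀ _ hM.ne'] at h3
    linarith
  · have h1 := (abs_le.1 (h.abs_form_le (t + j) (evolution T t j x))).1
    have h2 : ‖evolution T t j x‖ ^ 2 ≤ C ^ 2 := by gcongr; exact hC j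
    have h3 := mul_le_mul_of_nonneg_left h2 hM.le
    simp only [a]
    linarith

lemma le_form_of_mem_boundedForward (h : ContractingForms T S M ε p) {t : ℤ} {x : E}
    (hx : x ∈ boundedForward T t) : ε * ‖x‖ ^ 2 ≤ inner ℝ (S t x) x := by
  have h1 := h.form_nonneg_of_mem_boundedForward
    (map_boundedForward_le T t (Submodule.mem_map_of_mem hx))
  have h2 := h.drop t x
  linarith

/-- Once positive along a backward orbit, the form would grow exponentially backward in time. -/
lemma form_nonpos_of_mem_boundedBackward (h : ContractingForms T S M ε p) {t : ℤ} {x : E}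
    (hx : x ∈ boundedBackward T t) : inner ℝ (S t x) x ≤ 0 := by
  obtain ⟨w, rfl, hw, C, hC⟩ := mem_boundedBackward.1 hx
  let a : ℕ → ℝ := fun k => -inner ℝ (S (t - k) (w k)) (w k)
  have hM := h.M_pos
  have ha0 : a 0 = -inner ℝ (S t (w 0)) (w 0) := by simp [a]
  have : 0 ≤ a 0 := by
    refine nonneg_of_le_one_add_mul (κ := ε / M) (b := -(M * C ^ 2)) (div_pos h.pos hM)
      (fun j => ?_) (fun j => ?_)
    · have h1 : a (j + 1) ≤ a j - ε * ‖w (j + 1)‖ ^ 2 := by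
        have := h.drop (t - j - 1) (w (j + 1))
        rw [hw j, sub_add_cancel] at this
        simp only [a]
        rw [show t - ((j + 1 : ℕ) : ℤ) = t - j - 1 by push_cast; ring]
        linarith
      have h2 : -a (j + 1) ≤ M * ‖w (j + 1)‖ ^ 2 := by
        have := (abs_le.1 (h.abs_form_le (t - (j + 1 : ℕ)) (w (j + 1)))).2
        simp only [a]
        linarith
      have h3 : ε / M * (-a (j + 1)) ≤ ε / M * (M * ‖w (j + 1)‖ ^ 2) :=
        mul_le_mul_of_nonneg_left h2 (div_pos h.pos hM).le
      rw [← mul_assoc, div_mul_cancel₀ _ hM.ne'] at h3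
      have h4 : a (j + 1) ≤ a j := by
        have := mul_nonneg h.pos.le (sq_nonneg ‖w (j + 1)‖)
        linarith
      have h5 := mul_le_mul_of_nonneg_left h4 (div_pos h.pos hM).le
      linarith
    · have h1 := (abs_le.1 (h.abs_form_le (t - j) (w j))).2
      have h2 : ‖w j‖ ^ 2 ≤ C ^ 2 := by gcongr; exact hC j
      have h3 := mul_le_mul_of_nonneg_left h2 hM.le
      simp only [a]
      linarith
  linarith

lemma norm_le_of_norm_sq_le (h : ContractingForms T S M ε p) {x y : E}
    (hxy : ε * ‖x‖ ^ 2 ≤ M * ‖y‖ ^ 2) : ‖x‖ ≤ √(M / ε) * ‖y‖ := by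
  refine le_of_sq_le_sq ?_ (by positivity)
  rw [mul_pow, Real.sq_sqrt (div_pos h.M_pos h.pos).le, div_mul_eq_mul_div, le_div_iff₀ h.pos]
  linarith

variable [FiniteDimensional ℝ E]

/-- Histories of length `k` are provided by the preimage under `evolution T t (k + 1)` of a subspace
on which the form is nonnegative. -/
lemma sub_le_finrank_boundedForward (h : ContractingForms T S M ε p) (t : ℤ) :
    Module.finrank ℝ E - p ≤ Module.finrank ℝ (boundedForward T t) := by
  refine le_finrank_boundedStart _ _ (√(M / ε)) fun k => ?_
  obtain ⟨U, hU, hUpos⟩ := h.pos_space (t + (k + 1 : ℕ))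
  refine ⟨U.comap (evolution T t (k + 1)), ?_, fun x hx => ?_⟩
  · -- a preimage has at most the codimension of the subspace
    have h1 := LinearMap.finrank_range_add_finrank_ker (U.mkQ ∘ₗ evolution T t (k + 1))
    rw [LinearMap.ker_comp, Submodule.ker_mkQ] at h1
    have h2 := (LinearMap.range (U.mkQ ∘ₗ evolution T t (k + 1))).finrank_le
    have h3 := U.finrank_quotient_add_finrank
    omega
  · refine ⟨fun j => if j ≤ k then evolution T t j x else 0, by simp, fun j hj => ?_, fun j => ?_⟩
    · dsimp only
      rw [if_pos hj.le, if_pos (by omega)]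
      exact (LinearMap.mem_graph_iff _ _).2 rfl
    · dsimp only
      split_ifs with hj
      · refine h.norm_le_of_norm_sq_le (h.evolution_norm_sq_le t j ?_)
        obtain ⟨i, hi⟩ := Nat.exists_eq_add_of_le (show j + 1 ≤ k + 1 by omega)
        have h1 := h.form_evolution_le (t + (j + 1 : ℕ)) i (evolution T t (j + 1) x)
        rw [← evolution_add_apply, ← hi, show t + ((j + 1 : ℕ) : ℤ) + i = t + (k + 1 : ℕ) by
          rw [hi]; push_cast; ring] at h1
        exact (hUpos _ hx).trans h1
      · simpa using mul_nonneg (Real.sqrt_nonneg _) (norm_nonneg x)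

/-- Histories of length `k` are provided by the image under `evolution T (t - k) k` of a subspace on
which the form is nonpositive; the evolution is injective there. -/
lemma le_finrank_boundedBackward (h : ContractingForms T S M ε p) (t : ℤ) :
    p ≤ Module.finrank ℝ (boundedBackward T t) := by
  refine le_finrank_boundedStart _ _ (√(M / ε)) fun k => ?_
  obtain ⟨U, hU, hUneg⟩ := h.neg_space (t - k)
  have hlow : ∀ y ∈ U, ∀ j, ‖y‖ ≤ √(M / ε) * ‖evolution T (t - k) j y‖ := fun y hy j =>
    h.norm_le_of_norm_sq_le (h.norm_sq_le_evolution (t - k) j (hUneg y hy))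
  refine ⟨U.map (evolution T (t - k) k), ?_, ?_⟩
  · have hinj : Function.Injective ((evolution T (t - k) k).domRestrict U) := by
      rw [← LinearMap.ker_eq_bot, LinearMap.ker_eq_bot']
      intro y hy
      have := hlow y y.2 k
      rw [show evolution T (t - k) k y = 0 from hy] at this
      simpa using this
    rw [← LinearMap.range_domRestrict, LinearMap.finrank_range_of_inj hinj]
    exact hU
  · rintro _ ⟨y, hy, rfl⟩
    refine ⟨fun j => if j ≤ k then evolution T (t - k) (k - j) y else 0, by simp, fun j hj => ?_,
      fun j => ?_⟩
    · dsimp only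
      rw [if_pos hj.le, if_pos (by omega)]
      obtain ⟨i, rfl⟩ := Nat.exists_eq_add_of_lt hj
      rw [show j + i + 1 - j = i + 1 by omega, show j + i + 1 - (j + 1) = i by omega,
        evolution_succ_apply, show t - (j : ℤ) - 1 = t - (j + i + 1 : ℕ) + i by push_cast; ring]
      exact (LinearMap.mem_graph_iff _ _).2 rfl
    · dsimp only
      split_ifs with hj
      · refine h.norm_le_of_norm_sq_le ?_
        have h1 := h.norm_sq_le_evolution (t - k + (k - j : ℕ)) j
          (x := evolution T (t - k) (k - j) y)
          ((h.form_evolution_le (t - k) (k - j) y).trans (hUneg y hy))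
        rwa [← evolution_add_apply, Nat.sub_add_cancel hj] at h1
      · simpa using mul_nonneg (Real.sqrt_nonneg _) (norm_nonneg _)

end ContractingForms

end ContractingForms

/-! ### Domination and uniqueness -/

section Domination

variable {E : Type*} [NormedAddCommGroup E] [InnerProductSpace ℝ E]

/-- `H` dominates `V` along the evolution of `T`: nonzero vectors of `H` stay nonzero, and vectors
of `V` decay exponentially (for `0 < ρ < 1`) relative to vectors of `H`. Written without quotients,
so that rescaling the maps `T t` visibly does not matter. -/
def Dominates (T : ℤ → E →ₗ[ℝ] E) (H V : ℤ → Submodule ℝ E) (C ρ : ℝ) : Prop :=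
  ∀ (s : ℤ) (k : ℕ), ∀ x ∈ H s, x ≠ 0 → evolution T s k x ≠ 0 ∧
    ∀ y ∈ V s, ‖evolution T s k y‖ * ‖x‖ ≤ C * ρ ^ k * (‖y‖ * ‖evolution T s k x‖)

/-- It suffices to bound the forward orbit at large times. -/
lemma mem_boundedForward_of_eventually {T : ℤ → E →ₗ[ℝ] E} {t : ℤ} {x : E} {C : ℝ}
    (h : ∀ᶠ k in Filter.atTop, ‖evolution T t k x‖ ≤ C) : x ∈ boundedForward T t := by
  obtain ⟨D, hD⟩ := Filter.IsBoundedUnder.bddAbove_range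
    (f := fun k => ‖evolution T t k x‖) ⟨C, by simpa using h⟩
  exact mem_boundedForward.2 ⟨D, fun k => hD ⟨k, rfl⟩⟩

namespace ContractingForms

variable {T S : ℤ → E →ₗ[ℝ] E} {M ε : ℝ} {p : ℕ}

lemma rate_pos (h : ContractingForms T S M ε p) : 0 < 1 - ε / M := by
  have := (div_lt_one h.M_pos).2 h.lt
  linarith

lemma rate_lt_one (h : ContractingForms T S M ε p) : 1 - ε / M < 1 := by
  have := div_pos h.pos h.M_pos
  linarith

/-- Since the form is at most `M ‖x‖ ^ 2`, the decrease by `ε ‖x‖ ^ 2` in each step is at least a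
fixed proportion of its value. -/
lemma form_evolution_le_pow (h : ContractingForms T S M ε p) (s : ℤ) (k : ℕ) (y : E) :
    inner ℝ (S (s + k) (evolution T s k y)) (evolution T s k y) ≤
      (1 - ε / M) ^ k * inner ℝ (S s y) y := by
  induction k with
  | zero => simp
  | succ k ih =>
    set z := evolution T s k y
    have h1 := h.drop (s + k) z
    have h2 := mul_le_mul_of_nonneg_left (abs_le.1 (h.abs_form_le (s + k) z)).2
      (div_pos h.pos h.M_pos).le
    rw [← mul_assoc, div_mul_cancel₀ _ h.M_pos.ne'] at h2
    rw [evolution_succ_apply, show s + ((k + 1 : ℕ) : ℤ) = s + k + 1 by push_cast; ring, pow_succ']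
    have h3 := mul_le_mul_of_nonneg_left ih h.rate_pos.le
    calc _ ≤ inner ℝ (S (s + k) z) z - ε * ‖z‖ ^ 2 := h1
      _ ≤ (1 - ε / M) * inner ℝ (S (s + k) z) z := by linarith
      _ ≤ _ := by linarith

lemma norm_evolution_le_of_mem_boundedForward (h : ContractingForms T S M ε p) (s : ℤ) (k : ℕ)
    {y : E} (hy : y ∈ boundedForward T s) :
    ‖evolution T s k y‖ ≤ √(M / ε) * √(1 - ε / M) ^ k * ‖y‖ := by
  have h1 := h.le_form_of_mem_boundedForward (evolution_mem (map_boundedForward_le T) s k hy)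
  have h2 := h.form_evolution_le_pow s k y
  have h3 := mul_le_mul_of_nonneg_left (abs_le.1 (h.abs_form_le s y)).2
    (pow_nonneg h.rate_pos.le k)
  refine le_of_sq_le_sq ?_ (by positivity)
  rw [mul_pow, mul_pow, ← pow_mul, mul_comm k 2, pow_mul, Real.sq_sqrt h.rate_pos.le,
    Real.sq_sqrt (div_pos h.M_pos h.pos).le, mul_assoc, div_mul_eq_mul_div, le_div_iff₀ h.pos]
  linarith

lemma dominates (h : ContractingForms T S M ε p) :
    Dominates T (boundedBackward T) (boundedForward T) (M / ε) √(1 - ε / M) := by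
  intro s k x hx hx0
  have h1 : ‖x‖ ≤ √(M / ε) * ‖evolution T s k x‖ := h.norm_le_of_norm_sq_le
    (h.norm_sq_le_evolution s k (h.form_nonpos_of_mem_boundedBackward hx))
  refine ⟨fun h0 => hx0 (by simpa [h0] using h1), fun y hy => ?_⟩
  have h2 := h.norm_evolution_le_of_mem_boundedForward s k hy
  calc _ ≤ (√(M / ε) * √(1 - ε / M) ^ k * ‖y‖) * (√(M / ε) * ‖evolution T s k x‖) := by gcongr
    _ = (√(M / ε) * √(M / ε)) * √(1 - ε / M) ^ k * (‖y‖ * ‖evolution T s k x‖) := by ring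
    _ = _ := by rw [Real.mul_self_sqrt (div_pos h.M_pos h.pos).le]

/-- The angle between `boundedBackward` and `boundedForward` is bounded away from zero, uniformly in
time. -/
lemma norm_le_of_mem (h : ContractingForms T S M ε p) {t : ℤ} {x y : E}
    (hx : x ∈ boundedBackward T t) (hy : y ∈ boundedForward T t) :
    ‖y‖ ≤ 3 * M / ε * ‖x + y‖ := by
  have h1 := h.form_nonpos_of_mem_boundedBackward hx
  have h2 := h.le_form_of_mem_boundedForward hy
  obtain ⟨z, hz⟩ : ∃ z, z = x + y := ⟨_, rfl⟩
  have hx' : x = z - y := by rw [hz]; abel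
  rw [← hz]
  rw [hx', map_sub, inner_sub_left, inner_sub_right, inner_sub_right, h.symm t y z,
    real_inner_comm (S t z) y] at h1
  have h3 := (abs_le.1 (h.abs_form_le t z)).1
  have h4 : inner ℝ (S t z) y ≤ M * ‖z‖ * ‖y‖ :=
    (real_inner_le_norm _ _).trans (by gcongr; exact h.bound t z)
  have hM := h.M_pos
  have hε := h.pos
  rw [div_mul_eq_mul_div, le_div_iff₀ hε]
  rcases le_total ‖y‖ ‖z‖ with hyz | hyz
  · nlinarith [h.lt, norm_nonneg y, norm_nonneg z]
  · rcases (norm_nonneg y).eq_or_lt with h0 | h0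
    · rw [← h0, zero_mul]; positivity
    · have h5 : M * ‖z‖ ^ 2 ≤ M * ‖z‖ * ‖y‖ := by
        rw [pow_two, ← mul_assoc]; gcongr
      refine le_of_mul_le_mul_right ?_ h0
      linarith

lemma disjoint (h : ContractingForms T S M ε p) (t : ℤ) :
    Disjoint (boundedBackward T t) (boundedForward T t) := by
  rw [Submodule.disjoint_def]
  intro x hx hx'
  have h1 := h.form_nonpos_of_mem_boundedBackward hx
  have h2 := h.le_form_of_mem_boundedForward hx'
  have h3 : ‖x‖ ^ 2 ≤ 0 := by nlinarith [h.pos]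
  simpa using le_antisymm h3 (sq_nonneg _)

variable [FiniteDimensional ℝ E]

lemma isCompl (h : ContractingForms T S M ε p) (t : ℤ) :
    IsCompl (boundedBackward T t) (boundedForward T t) := by
  refine ⟨h.disjoint t, codisjoint_iff.2 (Submodule.eq_top_of_disjoint _ _ ?_ (h.disjoint t))⟩
  have := h.le_finrank_boundedBackward t
  have := h.sub_le_finrank_boundedForward t
  omega

lemma finrank_boundedBackward (h : ContractingForms T S M ε p) (hp : p ≤ Module.finrank ℝ E)
    (t : ℤ) : Module.finrank ℝ (boundedBackward T t) = p := by
  have := h.le_finrank_boundedBackward t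
  have := h.sub_le_finrank_boundedForward t
  have := Submodule.finrank_add_eq_of_isCompl (h.isCompl t)
  omega

lemma finrank_boundedForward (h : ContractingForms T S M ε p) (hp : p ≤ Module.finrank ℝ E)
    (t : ℤ) : Module.finrank ℝ (boundedForward T t) = Module.finrank ℝ E - p := by
  have := h.finrank_boundedBackward hp t
  have := Submodule.finrank_add_eq_of_isCompl (h.isCompl t)
  omega

variable {H V : ℤ → Submodule ℝ E} {C ρ : ℝ}

/-- The dominated part of any dominated splitting of the right dimensions is determined by the
dynamics. If a bounded forward orbit had a nonzero component in `H`, then so would be the orbit of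
this component, as it outgrows the component in `V`; but then all of `V s` would have bounded
forward orbits, too. -/
theorem eq_boundedForward (h : ContractingForms T S M ε p) (hp : p ≤ Module.finrank ℝ E)
    (hHV : ∀ t, IsCompl (H t) (V t)) (hV : ∀ t, Module.finrank ℝ (V t) = Module.finrank ℝ E - p)
    (hρ0 : 0 < ρ) (hρ1 : ρ < 1) (hdom : Dominates T H V C ρ) (s : ℤ) :
    V s = boundedForward T s := by
  have hrank := (hV s).trans (h.finrank_boundedForward hp s).symm
  have hlim : ∀ c : ℝ, Filter.Tendsto (fun k : ℕ => C * ρ ^ k * c) Filter.atTop (nhds 0) := by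
    intro c
    simpa using ((tendsto_pow_atTop_nhds_zero_of_lt_one hρ0.le hρ1).const_mul C).mul_const c
  -- a bounded orbit in `H` bounds all orbits in `V`, so that `V s` is all of `boundedForward T s`
  have hdisj : ∀ x ∈ H s, x ∈ boundedForward T s → x = 0 := by
    intro x hx hx'
    by_contra hx0
    obtain ⟨R, hR⟩ := mem_boundedForward.1 hx'
    have hle : V s ≤ boundedForward T s := by
      intro y hy
      have hxpos : 0 < ‖x‖ := norm_pos_iff.2 hx0
      refine mem_boundedForward_of_eventually (C := ‖y‖ * R / ‖x‖) ?_
      filter_upwards [(hlim 1).eventually_le_const one_pos] with k hk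
      rw [le_div_iff₀ hxpos]
      calc _ ≤ C * ρ ^ k * (‖y‖ * ‖evolution T s k x‖) := (hdom s k x hx hx0).2 y hy
        _ ≤ 1 * (‖y‖ * ‖evolution T s k x‖) := by
          rw [mul_one] at hk
          gcongr
        _ ≤ _ := by
          rw [one_mul]
          gcongr
          exact hR k
    have heq := Submodule.eq_of_le_of_finrank_eq hle hrank
    exact hx0 ((Submodule.disjoint_def.1 (hHV s).disjoint) x hx (heq ▸ hx'))
  symm
  refine Submodule.eq_of_le_of_finrank_eq (fun w hw => ?_) hrank.symm
  obtain ⟨x, hx, y, hy, rfl⟩ := Submodule.mem_sup.1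
    ((hHV s).sup_eq_top ▸ Submodule.mem_top : w ∈ H s ⊔ V s)
  suffices x = 0 by simpa [this] using hy
  by_contra hx0
  have hxpos : 0 < ‖x‖ := norm_pos_iff.2 hx0
  obtain ⟨R, hR⟩ := mem_boundedForward.1 hw
  refine hx0 (hdisj x hx (mem_boundedForward_of_eventually (C := 2 * R) ?_))
  filter_upwards [(hlim (‖y‖ / ‖x‖)).eventually_le_const (by norm_num : (0 : ℝ) < 1 / 2)] with k hk
  have h1 : ‖evolution T s k y‖ ≤ 1 / 2 * ‖evolution T s k x‖ := by
    refine le_of_mul_le_mul_right ?_ hxpos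
    calc _ ≤ C * ρ ^ k * (‖y‖ * ‖evolution T s k x‖) := (hdom s k x hx hx0).2 y hy
      _ = C * ρ ^ k * (‖y‖ / ‖x‖) * (‖evolution T s k x‖ * ‖x‖) := by field_simp
      _ ≤ 1 / 2 * (‖evolution T s k x‖ * ‖x‖) := by gcongr
      _ = _ := by ring
  have h2 : ‖evolution T s k x‖ ≤ R + ‖evolution T s k y‖ := by
    calc _ = ‖evolution T s k (x + y) - evolution T s k y‖ := by rw [map_add, add_sub_cancel_right]
      _ ≤ _ := (norm_sub_le _ _).trans (by gcongr; exact hR k)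
  linarith

/-- Domination makes the evolution injective on `H`, so that it maps `H s` onto `H (s + k)`. -/
lemma map_evolution_eq (hH : ∀ t, Module.finrank ℝ (H t) = p)
    (hinv : ∀ t, (H t).map (T t) ≤ H (t + 1)) (hdom : Dominates T H V C ρ) (s : ℤ) (k : ℕ) :
    (H s).map (evolution T s k) = H (s + k) := by
  refine Submodule.eq_of_le_of_finrank_eq ?_ ?_
  · rintro _ ⟨x, hx, rfl⟩
    exact evolution_mem hinv s k hx
  · have hinj : Function.Injective ((evolution T s k).domRestrict (H s)) := by
      rw [← LinearMap.ker_eq_bot, LinearMap.ker_eq_bot']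
      intro y hy
      by_contra hy0
      exact (hdom s k y y.2 (by simpa using hy0)).1 hy
    rw [← LinearMap.range_domRestrict, LinearMap.finrank_range_of_inj hinj, hH, hH]

/-- The dominating part of any dominated splitting of the right dimensions is determined by the
dynamics. A point of `H t` is the image of points `y k ∈ H (t - k)`, whose components in
`V (t - k) = boundedForward T (t - k)` are bounded in terms of `y k`, by the uniform angle bound for
the splitting into bounded backward and forward orbits; domination then forces the component
at time `t` to vanish. The angle between `H` and `V` plays no role. -/
theorem eq_boundedBackward (h : ContractingForms T S M ε p) (hp : p ≤ Module.finrank ℝ E)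
    (hHV : ∀ t, IsCompl (H t) (V t)) (hH : ∀ t, Module.finrank ℝ (H t) = p)
    (hV : ∀ t, Module.finrank ℝ (V t) = Module.finrank ℝ E - p)
    (hinv : ∀ t, (H t).map (T t) ≤ H (t + 1)) (hC : 0 ≤ C)
    (hρ0 : 0 < ρ) (hρ1 : ρ < 1) (hdom : Dominates T H V C ρ) (t : ℤ) :
    H t = boundedBackward T t := by
  refine Submodule.eq_of_le_of_finrank_eq (fun x hx => ?_)
    ((hH t).trans (h.finrank_boundedBackward hp t).symm)
  obtain ⟨u, hu, v, hv, rfl⟩ := Submodule.mem_sup.1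
    ((h.isCompl t).sup_eq_top ▸ Submodule.mem_top :
      x ∈ boundedBackward T t ⊔ boundedForward T t)
  -- `u` and `v` are the components of `x`, and `a` and `b` below those of its preimage at `t - k`
  suffices v = 0 by simpa [this] using hu
  rcases eq_or_ne (u + v) 0 with h0 | hne
  · have hv' : v = -u := by rw [eq_neg_iff_add_eq_zero, add_comm]; exact h0
    exact Submodule.disjoint_def.1 (h.disjoint t) v (hv' ▸ neg_mem hu) hv
  have hbound : ∀ k : ℕ, ‖v‖ ≤ C * ρ ^ k * (3 * M / ε * ‖u + v‖) := by
    intro k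
    have hmap := map_evolution_eq hH hinv hdom (t - k) k
    rw [sub_add_cancel] at hmap
    obtain ⟨y, hy, hyx⟩ := (hmap ▸ hx : u + v ∈ (H (t - k)).map (evolution T (t - k) k))
    obtain ⟨a, ha, b, hb, rfl⟩ := Submodule.mem_sup.1
      ((h.isCompl (t - k)).sup_eq_top ▸ Submodule.mem_top :
        y ∈ boundedBackward T (t - k) ⊔ boundedForward T (t - k))
    have hy0 : a + b ≠ 0 := fun h0 => hne (by rw [← hyx, h0, map_zero])
    have hev : evolution T (t - k) k b = v := by
      have ha' := evolution_mem (map_boundedBackward_le T) (t - k) k ha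
      have hb' := evolution_mem (map_boundedForward_le T) (t - k) k hb
      rw [sub_add_cancel] at ha' hb'
      rw [map_add] at hyx
      have h1 : evolution T (t - k) k b - v = u - evolution T (t - k) k a :=
        sub_eq_sub_iff_add_eq_add.2 (by rw [add_comm, hyx])
      exact sub_eq_zero.1 (Submodule.disjoint_def.1 (h.disjoint t) _ (h1 ▸ sub_mem hu ha')
        (sub_mem hb' hv))
    have hbV : b ∈ V (t - k) := by
      rwa [h.eq_boundedForward hp hHV hV hρ0 hρ1 hdom]
    have h2 := (hdom (t - k) k _ hy hy0).2 b hbV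
    rw [hev, hyx] at h2
    refine le_of_mul_le_mul_right ?_ (norm_pos_iff.2 hy0)
    calc _ ≤ _ := h2
      _ ≤ C * ρ ^ k * ((3 * M / ε * ‖a + b‖) * ‖u + v‖) := by
        gcongr
        exact h.norm_le_of_mem ha hb
      _ = _ := by ring
  have hlim : Filter.Tendsto (fun k : ℕ => C * ρ ^ k * (3 * M / ε * ‖u + v‖)) Filter.atTop
      (nhds 0) := by
    simpa using ((tendsto_pow_atTop_nhds_zero_of_lt_one hρ0.le hρ1).const_mul C).mul_const
      (3 * M / ε * ‖u + v‖)
  exact norm_le_zero_iff.1 (ge_of_tendsto' hlim hbound)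

end ContractingForms

end Domination

/-! ### The strict S-lemma -/

section SLemma

variable {E : Type*} [NormedAddCommGroup E] [InnerProductSpace ℝ E]

lemma form_add_smul {F : E →ₗ[ℝ] E} (hF : F.IsSymmetric) (x y : E) (s : ℝ) :
    inner ℝ (F (x + s • y)) (x + s • y) =
      inner ℝ (F x) x + 2 * s * inner ℝ (F x) y + s ^ 2 * inner ℝ (F y) y := by
  have h : inner ℝ (F y) x = inner ℝ (F x) y := by rw [hF y x, real_inner_comm]
  simp only [map_add, map_smul, inner_add_left, inner_add_right, inner_smul_left,
    inner_smul_right, h, conj_trivial]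
  ring

lemma form_smul (F : E →ₗ[ℝ] E) (c : ℝ) (x : E) :
    inner ℝ (F (c • x)) (c • x) = c ^ 2 * inner ℝ (F x) x := by
  simp only [map_smul, inner_smul_left, inner_smul_right, conj_trivial]
  ring

/-- On the plane spanned by `x` and `y`, the form `F` is indefinite; comparing `G` on its two
isotropic lines, in a combination that cancels the mixed term, gives the inequality between the
quotients of `G` by `F` at `x` and `y`. -/
lemma form_mul_lt_form_mul {F G : E →ₗ[ℝ] E} (hF : F.IsSymmetric) (hG : G.IsSymmetric)
    (hFG : ∀ z ≠ 0, inner ℝ (F z) z ≤ 0 → inner ℝ (G z) z < 0) {x y : E}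
    (hx : inner ℝ (F x) x < 0) (hy : 0 < inner ℝ (F y) y) :
    inner ℝ (G x) x * inner ℝ (F y) y < inner ℝ (G y) y * inner ℝ (F x) x := by
  set a := inner ℝ (F x) x with ha
  set c := inner ℝ (F y) y with hc
  set b := inner ℝ (F x) y with hb
  set D := √(b ^ 2 - a * c) with hD
  have hac : 0 < -(a * c) := by nlinarith
  have hD2 : D ^ 2 = b ^ 2 - a * c := Real.sq_sqrt (by nlinarith [sq_nonneg b])
  have hbD : |b| < D := by
    rw [← Real.sqrt_sq_eq_abs]
    exact Real.sqrt_lt_sqrt (sq_nonneg b) (by linarith)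
  obtain ⟨hb1, hb2⟩ := abs_lt.1 hbD
  -- the roots of this quadratic give the isotropic vectors `x + s • y` of `F`
  have key : ∀ s : ℝ, c * s ^ 2 + 2 * b * s + a = 0 → inner ℝ (G x) x + 2 * s * inner ℝ (G x) y +
      s ^ 2 * inner ℝ (G y) y < 0 := by
    intro s hs
    rw [← form_add_smul hG]
    refine hFG _ (fun h0 => ?_) ?_
    · have hxs : x = (-s) • y := by rw [neg_smul]; exact eq_neg_of_add_eq_zero_left h0
      have : a = (-s) ^ 2 * c := by rw [ha, hxs, form_smul]
      nlinarith [sq_nonneg s]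
    · rw [form_add_smul hF, ← ha, ← hb, ← hc]
      linarith
  have h1 := key ((-b - D) / c) (by field_simp; linear_combination hD2)
  have h2 := key ((-b + D) / c) (by field_simp; linear_combination hD2)
  have h3 := mul_lt_mul_of_pos_left h1 (show 0 < -b + D by linarith)
  have h4 := mul_lt_mul_of_pos_left h2 (show 0 < b + D by linarith)
  have h5 : 2 * D * (inner ℝ (G x) x * c - inner ℝ (G y) y * a) < 0 := by
    have h6 := mul_neg_of_pos_of_neg hy (show
      (-b + D) * (inner ℝ (G x) x + 2 * ((-b - D) / c) * inner ℝ (G x) y +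
        ((-b - D) / c) ^ 2 * inner ℝ (G y) y) +
      (b + D) * (inner ℝ (G x) x + 2 * ((-b + D) / c) * inner ℝ (G x) y +
        ((-b + D) / c) ^ 2 * inner ℝ (G y) y) < 0 by linarith)
    have hpoly : ∀ u v w : ℝ,
        c * ((-b + D) * (u + 2 * ((-b - D) / c) * v + ((-b - D) / c) ^ 2 * w) +
        (b + D) * (u + 2 * ((-b + D) / c) * v + ((-b + D) / c) ^ 2 * w)) =
        2 * D * (u * c - w * a) := by
      intro u v w
      have hc0 : c ≠ 0 := hy.ne'
      field_simp
      linear_combination (2 * D * w) * hD2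
    rwa [hpoly] at h6
  have hD0 : 0 < 2 * D := by linarith [abs_nonneg b]
  exact sub_neg.1 (neg_of_mul_neg_right h5 hD0.le)

variable [FiniteDimensional ℝ E]

/-- The strict S-lemma for symmetric operators, with a positive multiplier: the multiplier is the
infimum of the quotients of the two forms where `F` is negative. -/
theorem exists_multiplier {F G : E →ₗ[ℝ] E} (hF : F.IsSymmetric) (hG : G.IsSymmetric)
    (hFG : ∀ z ≠ 0, inner ℝ (F z) z ≤ 0 → inner ℝ (G z) z < 0)
    (hneg : ∃ x, inner ℝ (F x) x < 0) :
    ∃ τ ε : ℝ, 0 < τ ∧ 0 < ε ∧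
      ∀ x, inner ℝ (G x) x ≤ τ * inner ℝ (F x) x - ε * ‖x‖ ^ 2 := by
  obtain ⟨x₀, hx₀⟩ := hneg
  have hcont : ∀ L : E →ₗ[ℝ] E, Continuous fun x => inner ℝ (L x) x := fun L =>
    L.continuous_of_finiteDimensional.inner continuous_id
  have hunit : ∀ x : E, x ≠ 0 → ‖‖x‖⁻¹ • x‖ = 1 := fun x hx => by
    rw [norm_smul, norm_inv, norm_norm, inv_mul_cancel₀ (norm_ne_zero_iff.2 hx)]
  -- on the cone, `G` is bounded away from zero, by compactness of the unit sphere
  obtain ⟨δ, hδ, hGδ⟩ : ∃ δ > 0, ∀ x, inner ℝ (F x) x ≤ 0 →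
      inner ℝ (G x) x ≤ -(2 * δ) * ‖x‖ ^ 2 := by
    have hx₀0 : x₀ ≠ 0 := fun h => by simp [h] at hx₀
    obtain ⟨z, ⟨hz1, hz2⟩, hzmax⟩ := ((isCompact_sphere (0 : E) 1).inter_right
      (isClosed_le (hcont F) continuous_const)).exists_isMaxOn (f := fun x => inner ℝ (G x) x)
      ⟨‖x₀‖⁻¹ • x₀, by simpa using hunit x₀ hx₀0, by
        change inner ℝ (F _) _ ≤ (0 : ℝ)
        rw [form_smul]
        exact mul_nonpos_of_nonneg_of_nonpos (sq_nonneg _) hx₀.le⟩ (hcont G).continuousOn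
    have hz0 : z ≠ 0 := fun h => by simp [h] at hz1
    have hGz := hFG z hz0 hz2
    refine ⟨-inner ℝ (G z) z / 2, by linarith, fun x hx => ?_⟩
    rcases eq_or_ne x 0 with rfl | hx0
    · simp
    have hxpos : 0 < ‖x‖ := norm_pos_iff.2 hx0
    have h1 : inner ℝ (G (‖x‖⁻¹ • x)) (‖x‖⁻¹ • x) ≤ inner ℝ (G z) z :=
      hzmax ⟨by simpa using hunit x hx0, by
        change inner ℝ (F _) _ ≤ (0 : ℝ)
        rw [form_smul]
        exact mul_nonpos_of_nonneg_of_nonpos (sq_nonneg _) hx⟩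
    rw [form_smul, inv_pow, inv_mul_le_iff₀ (by positivity)] at h1
    linarith
  obtain ⟨M, hM, hFM⟩ : ∃ M > 0, ∀ x, -inner ℝ (F x) x ≤ M * ‖x‖ ^ 2 := by
    refine ⟨‖F.toContinuousLinearMap‖ + 1, by positivity, fun x => ?_⟩
    have h1 : ‖F x‖ ≤ ‖F.toContinuousLinearMap‖ * ‖x‖ := F.toContinuousLinearMap.le_opNorm x
    have h2 := (abs_le.1 (abs_real_inner_le_norm (F x) x)).1
    nlinarith [norm_nonneg x, sq_nonneg ‖x‖]
  set G' : E →ₗ[ℝ] E := G + δ • LinearMap.id with hG'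
  have hG'x : ∀ x, inner ℝ (G' x) x = inner ℝ (G x) x + δ * ‖x‖ ^ 2 := fun x => by
    simp [hG', inner_add_left, inner_smul_left]
  have hG's : G'.IsSymmetric := fun x y => by
    simp [hG', inner_add_left, inner_add_right, inner_smul_left, inner_smul_right, hG x y]
  have hG'le : ∀ x, inner ℝ (F x) x ≤ 0 → inner ℝ (G' x) x ≤ -δ * ‖x‖ ^ 2 := fun x hx => by
    rw [hG'x]
    linarith [hGδ x hx]
  have hFG' : ∀ z ≠ 0, inner ℝ (F z) z ≤ 0 → inner ℝ (G' z) z < 0 := fun z hz hFz => by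
    have : 0 < δ * ‖z‖ ^ 2 := by positivity
    linarith [hG'le z hFz]
  set R : {x : E // inner ℝ (F x) x < 0} → ℝ := fun x => inner ℝ (G' x) x / inner ℝ (F x) x with hR
  have hRge : ∀ x, δ / M ≤ R x := by
    rintro ⟨x, hx⟩
    rw [hR, le_div_iff_of_neg hx, div_mul_eq_mul_div, le_div_iff₀ hM]
    have h1 := mul_le_mul_of_nonneg_left (hFM x) hδ.le
    have h2 := mul_le_mul_of_nonneg_left (hG'le x hx.le) hM.le
    linarith
  have : Nonempty {x : E // inner ℝ (F x) x < 0} := ⟨⟨x₀, hx₀⟩⟩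
  have hbdd : BddBelow (Set.range R) := ⟨δ / M, by rintro _ ⟨x, rfl⟩; exact hRge x⟩
  refine ⟨⨅ x, R x, δ, (div_pos hδ hM).trans_le (le_ciInf hRge), hδ, fun x => ?_⟩
  suffices inner ℝ (G' x) x ≤ (⨅ x, R x) * inner ℝ (F x) x by
    rw [hG'x] at this
    linarith
  rcases lt_trichotomy (inner ℝ (F x) x) 0 with hx | hx | hx
  · exact (le_div_iff_of_neg hx).1 (ciInf_le hbdd ⟨x, hx⟩)
  · rw [hx, mul_zero]
    exact (hG'le x hx.le).trans (by nlinarith [sq_nonneg ‖x‖])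
  · rw [← div_le_iff₀ hx]
    refine le_ciInf fun ⟨y, hy⟩ => ?_
    rw [hR, le_div_iff_of_neg hy, div_mul_eq_mul_div, le_div_iff₀ hx]
    exact (form_mul_lt_form_mul hF hG's hFG' hy hx).le

/-- A linear map that strictly maps the cone of `F` into the cone of `F'` can be rescaled so that it
strictly decreases the quadratic forms. -/
theorem exists_rescaling {F F' A : E →ₗ[ℝ] E} (hF : F.IsSymmetric) (hF' : F'.IsSymmetric)
    (hA : ∀ z ≠ 0, inner ℝ (F z) z ≤ 0 → inner ℝ (F' (A z)) (A z) < 0)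
    (hneg : ∃ x, inner ℝ (F x) x < 0) :
    ∃ c ε : ℝ, 0 < c ∧ 0 < ε ∧ ∀ x, inner ℝ (F' ((c • A) x)) ((c • A) x) ≤
      inner ℝ (F x) x - ε * ‖x‖ ^ 2 := by
  set G : E →ₗ[ℝ] E := LinearMap.adjoint A ∘ₗ F' ∘ₗ A with hG
  have hGx : ∀ x y, inner ℝ (G x) y = inner ℝ (F' (A x)) (A y) := fun x y => by
    simp [hG, LinearMap.adjoint_inner_left]
  have hGs : G.IsSymmetric := fun x y => by
    rw [hGx, hF' (A x) (A y), real_inner_comm, ← hGx, real_inner_comm]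
  obtain ⟨τ, ε, hτ, hε, h⟩ := exists_multiplier hF hGs (by simpa only [hGx] using hA) hneg
  refine ⟨(√τ)⁻¹, ε / τ, by positivity, by positivity, fun x => ?_⟩
  have h1 := h x
  rw [hGx] at h1
  rw [LinearMap.smul_apply, form_smul, inv_pow, Real.sq_sqrt hτ.le, inv_mul_le_iff₀ hτ, mul_sub,
    ← mul_assoc, mul_div_cancel₀ _ hτ.ne']
  exact h1

omit [FiniteDimensional ℝ E] in
lemma form_neg_of_mem_interior {F : E →ₗ[ℝ] E} (hF : F.IsSymmetric)
    (hpos : ∃ y, 0 < inner ℝ (F y) y) {x : E}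
    (hx : x ∈ interior {z | inner ℝ (F z) z ≤ 0}) : inner ℝ (F x) x < 0 := by
  refine lt_of_le_of_ne
    (interior_subset hx : x ∈ {z | inner ℝ (F z) z ≤ 0}) fun h0 => ?_
  obtain ⟨y, hy, hxy⟩ : ∃ y, 0 < inner ℝ (F y) y ∧ 0 ≤ inner ℝ (F x) y := by
    obtain ⟨y, hy⟩ := hpos
    rcases le_total 0 (inner ℝ (F x) y) with hxy | hxy
    · exact ⟨y, hy, hxy⟩
    · exact ⟨-y, by simpa using hy, by simpa using hxy⟩
  have hlim : Filter.Tendsto (fun s : ℝ => x + s • y) (nhdsWithin 0 (Set.Ioi 0)) (nhds x) := by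
    have : Continuous fun s : ℝ => x + s • y := by fun_prop
    simpa using (this.tendsto 0).mono_left nhdsWithin_le_nhds
  obtain ⟨s, hs, hs0⟩ :=
    ((hlim.eventually (mem_interior_iff_mem_nhds.1 hx)).and self_mem_nhdsWithin).exists
  have hs1 : inner ℝ (F (x + s • y)) (x + s • y) ≤ 0 := hs
  rw [form_add_smul hF, h0] at hs1
  have h1 : 0 < s ^ 2 * inner ℝ (F y) y := mul_pos (pow_pos hs0 2) hy
  have h2 : 0 ≤ 2 * s * inner ℝ (F x) y := mul_nonneg (mul_nonneg zero_le_two (le_of_lt hs0)) hxy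
  linarith

end SLemma

/-! ### Quadratic cones and inertia of symmetric matrices -/

section Inertia

variable {n : ℕ} {P : Matrix (Fin n) (Fin n) ℝ}

lemma quadCone_eq (P : Matrix (Fin n) (Fin n) ℝ) :
    quadCone P = {x | inner ℝ (Matrix.toEuclideanLin P x) x ≤ 0} := by
  ext x
  simp [quadCone, EuclideanSpace.inner_eq_star_dotProduct]

lemma toEuclideanLin_eigenvectorBasis (hP : P.IsHermitian) (i : Fin n) :
    Matrix.toEuclideanLin P (hP.eigenvectorBasis i) =
      hP.eigenvalues i • hP.eigenvectorBasis i := by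
  apply (WithLp.ofLp_injective 2)
  exact hP.mulVec_eigenvectorBasis i

lemma form_eq_sum_eigenvalues (hP : P.IsHermitian) (x : StateSpace n) :
    inner ℝ (Matrix.toEuclideanLin P x) x =
      ∑ i, hP.eigenvalues i * inner ℝ (hP.eigenvectorBasis i) x ^ 2 := by
  rw [← hP.eigenvectorBasis.sum_inner_mul_inner]
  refine Finset.sum_congr rfl fun i _ => ?_
  rw [(Matrix.isSymmetric_toEuclideanLin_iff.2 hP) x, toEuclideanLin_eigenvectorBasis,
    inner_smul_right, real_inner_comm]
  ring

lemma exists_submodule_eigenvectors (hP : P.IsHermitian) (s : Finset (Fin n)) :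
    ∃ U : Submodule ℝ (StateSpace n), Module.finrank ℝ U = s.card ∧
      ∀ x ∈ U, inner ℝ (Matrix.toEuclideanLin P x) x =
        ∑ i ∈ s, hP.eigenvalues i * inner ℝ (hP.eigenvectorBasis i) x ^ 2 := by
  set b := hP.eigenvectorBasis
  refine ⟨Submodule.span ℝ (Set.range fun i : s => b i), ?_, fun x hx => ?_⟩
  · have hli : LinearIndependent ℝ fun i : s => b i :=
      (b.orthonormal.comp _ Subtype.val_injective).linearIndependent
    rw [finrank_span_eq_card hli, Fintype.card_coe]
  · rw [form_eq_sum_eigenvalues hP, Finset.sum_subset (Finset.subset_univ s)]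
    intro j _ hj
    have : inner ℝ (b j) x = 0 := by
      induction hx using Submodule.span_induction with
      | mem x hx =>
        obtain ⟨i, rfl⟩ := hx
        exact b.orthonormal.2 fun h => hj (h ▸ i.2)
      | zero => simp
      | add x y _ _ hx hy => rw [inner_add_right, hx, hy, add_zero]
      | smul c x _ hx => rw [inner_smul_right, hx, mul_zero]
    simp [b, this]

lemma HasInertia.isSymmetric {i j k : ℕ} (h : HasInertia P i j k) :
    (Matrix.toEuclideanLin P).IsSymmetric :=
  Matrix.isSymmetric_toEuclideanLin_iff.2 h.1

lemma HasInertia.add_add_eq {i j k : ℕ} (h : HasInertia P i j k) : i + j + k = n := by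
  obtain ⟨hP, rfl, rfl, rfl⟩ := h
  rw [← Finset.card_union_of_disjoint, ← Finset.card_union_of_disjoint]
  · convert Finset.card_fin n
    ext a
    simpa using (lt_trichotomy (hP.eigenvalues a) 0)
  · rw [Finset.disjoint_left]
    intro a
    simp only [Finset.mem_union, Finset.mem_filter, Finset.mem_univ, true_and]
    rintro (h | h) <;> linarith
  · rw [Finset.disjoint_left]
    intro a
    simp only [Finset.mem_filter, Finset.mem_univ, true_and]
    intro h
    exact h.ne

lemma HasInertia.exists_nonpos {i j k : ℕ} (h : HasInertia P i j k) :
    ∃ U : Submodule ℝ (StateSpace n), Module.finrank ℝ U = i ∧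
      ∀ x ∈ U, inner ℝ (Matrix.toEuclideanLin P x) x ≤ 0 := by
  obtain ⟨hP, hi, -, -⟩ := h
  obtain ⟨U, hU, hUx⟩ := exists_submodule_eigenvectors hP _
  refine ⟨U, hU.trans hi, fun x hx => ?_⟩
  rw [hUx x hx]
  exact Finset.sum_nonpos fun a ha =>
    mul_nonpos_of_nonpos_of_nonneg (Finset.mem_filter.1 ha).2.le (sq_nonneg _)

lemma HasInertia.exists_nonneg {i j k : ℕ} (h : HasInertia P i j k) :
    ∃ U : Submodule ℝ (StateSpace n), Module.finrank ℝ U = k ∧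
      ∀ x ∈ U, 0 ≤ inner ℝ (Matrix.toEuclideanLin P x) x := by
  obtain ⟨hP, -, -, hk⟩ := h
  obtain ⟨U, hU, hUx⟩ := exists_submodule_eigenvectors hP _
  refine ⟨U, hU.trans hk, fun x hx => ?_⟩
  rw [hUx x hx]
  exact Finset.sum_nonneg fun a ha => mul_nonneg (Finset.mem_filter.1 ha).2.le (sq_nonneg _)

lemma form_eigenvectorBasis (hP : P.IsHermitian) (a : Fin n) :
    inner ℝ (Matrix.toEuclideanLin P (hP.eigenvectorBasis a)) (hP.eigenvectorBasis a) =
      hP.eigenvalues a := by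
  rw [toEuclideanLin_eigenvectorBasis, inner_smul_left, real_inner_self_eq_norm_sq,
    hP.eigenvectorBasis.norm_eq_one]
  simp

lemma HasInertia.exists_neg {i j k : ℕ} (h : HasInertia P i j k) (hi : 0 < i) :
    ∃ x, inner ℝ (Matrix.toEuclideanLin P x) x < 0 := by
  obtain ⟨hP, rfl, -, -⟩ := h
  obtain ⟨a, ha⟩ := Finset.card_pos.1 hi
  exact ⟨hP.eigenvectorBasis a, by
    rw [form_eigenvectorBasis]; exact (Finset.mem_filter.1 ha).2⟩

lemma HasInertia.exists_pos {i j k : ℕ} (h : HasInertia P i j k) (hk : 0 < k) :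
    ∃ x, 0 < inner ℝ (Matrix.toEuclideanLin P x) x := by
  obtain ⟨hP, -, -, rfl⟩ := h
  obtain ⟨a, ha⟩ := Finset.card_pos.1 hk
  exact ⟨hP.eigenvectorBasis a, by
    rw [form_eigenvectorBasis]; exact (Finset.mem_filter.1 ha).2⟩

end Inertia

/-! ### Splittings of the switching system -/

section Splitting

/-- Domination is not affected by nonzero scalar factors of the maps. -/
lemma Dominates.of_smul {E : Type*} [NormedAddCommGroup E] [InnerProductSpace ℝ E]
    {T T' : ℤ → E →ₗ[ℝ] E} {c : ℤ → ℝ} (hc : ∀ t, c t ≠ 0) (hT : ∀ t, T' t = c t • T t)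
    {H V : ℤ → Submodule ℝ E} {C ρ : ℝ} (h : Dominates T H V C ρ) : Dominates T' H V C ρ := by
  have hevol : ∀ s k, ∃ a : ℝ, a ≠ 0 ∧ ∀ x, evolution T' s k x = a • evolution T s k x := by
    intro s k
    induction k with
    | zero => exact ⟨1, one_ne_zero, fun x => by simp⟩
    | succ k ih =>
      obtain ⟨a, ha, hax⟩ := ih
      refine ⟨c (s + k) * a, mul_ne_zero (hc _) ha, fun x => ?_⟩
      rw [evolution_succ_apply, evolution_succ_apply, hax, hT, LinearMap.smul_apply, map_smul,
        smul_smul]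
  intro s k x hx hx0
  obtain ⟨a, ha, hax⟩ := hevol s k
  obtain ⟨h1, h2⟩ := h s k x hx hx0
  refine ⟨by rw [hax]; exact smul_ne_zero ha h1, fun y hy => ?_⟩
  rw [hax, hax, norm_smul, norm_smul]
  calc _ = ‖a‖ * (‖evolution T s k y‖ * ‖x‖) := by ring
    _ ≤ ‖a‖ * (C * ρ ^ k * (‖y‖ * ‖evolution T s k x‖)) :=
      mul_le_mul_of_nonneg_left (h2 y hy) (norm_nonneg a)
    _ = _ := by ring

lemma map_le_of_smul {E : Type*} [AddCommGroup E] [Module ℝ E]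
    {T T' : ℤ → E →ₗ[ℝ] E} {c : ℤ → ℝ} (hT : ∀ t, T' t = c t • T t) {H : ℤ → Submodule ℝ E}
    (h : ∀ t, (H t).map (T t) ≤ H (t + 1)) (t : ℤ) : (H t).map (T' t) ≤ H (t + 1) := by
  rintro _ ⟨x, hx, rfl⟩
  rw [hT]
  exact (H (t + 1)).smul_mem _ (h t (Submodule.mem_map_of_mem hx))

variable {n N : ℕ} (A : Fin N → Matrix (Fin n) (Fin n) ℝ) (σ : ℤ → Fin N)

/-- The linear maps of the switching system along the switching signal `σ`. -/
noncomputable def switchedMap (t : ℤ) : StateSpace n →ₗ[ℝ] StateSpace n :=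
  Matrix.toEuclideanLin (A (σ t))

lemma toEuclideanLin_stepProduct (s : ℤ) (k : ℕ) :
    Matrix.toEuclideanLin (stepProduct A σ s k) = evolution (switchedMap A σ) s k := by
  induction k with
  | zero => exact Matrix.toLpLin_one 2
  | succ k ih =>
    rw [stepProduct, evolution, ← ih]
    exact Matrix.toLpLin_mul_same 2 _ _

lemma transitionMap_add (s : ℤ) (k : ℕ) :
    transitionMap A σ s (s + k) = evolution (switchedMap A σ) s k := by
  rw [transitionMap, add_sub_cancel_left, Int.toNat_natCast, toEuclideanLin_stepProduct]

variable {A σ} {H V : SubspaceCollection n}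

lemma Paired.projH_add (h : Paired H V) {t : ℤ} {x y : StateSpace n} (hx : x ∈ H t)
    (hy : y ∈ V t) : h.projH t (x + y) = x := by
  rw [Paired.projH, map_add, Submodule.projection_apply_of_mem_left _ hx,
    Submodule.projection_apply_of_mem_right _ hy, add_zero]

lemma Paired.projV_add (h : Paired H V) {t : ℤ} {x y : StateSpace n} (hx : x ∈ H t)
    (hy : y ∈ V t) : h.projV t (x + y) = y := by
  rw [Paired.projV, map_add, Submodule.projection_apply_of_mem_left _ hy,
    Submodule.projection_apply_of_mem_right _ hx, zero_add]

/-- If `V t ≠ ⊥`, the quotient form of the growth bound includes the nonvanishing of the left-hand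
denominator. -/
lemma RelativeGrowthBound.dominates (h : Paired H V) (hH : ForwardInvariant A σ H)
    (hV : ForwardInvariant A σ V) (hne : ∀ t, V t ≠ ⊥) {C ρ : ℝ}
    (hb : RelativeGrowthBound A σ h C ρ) : Dominates (switchedMap A σ) H V C ρ := by
  intro s k x hx hx0
  have hstep : ∀ y ∈ V s, evolution (switchedMap A σ) s k x ≠ 0 ∧
      ‖evolution (switchedMap A σ) s k y‖ / ‖evolution (switchedMap A σ) s k x‖ ≤
        C * ρ ^ k * (‖y‖ / ‖x‖) := by
    intro y hy
    have hy' := evolution_mem (T := switchedMap A σ) hV s k hy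
    have hx' := evolution_mem (T := switchedMap A σ) hH s k hx
    have := hb s (s + k) (by omega) (x + y) (by rwa [h.projH_add hx hy])
    rw [transitionMap_add, map_add, h.projH_add hx hy, h.projV_add hx hy, h.projH_add hx' hy',
      h.projV_add hx' hy', add_sub_cancel_left, zpow_natCast] at this
    exact ⟨this.1 (hne _), this.2⟩
  refine ⟨(hstep 0 (V s).zero_mem).1, fun y hy => ?_⟩
  obtain ⟨h1, h2⟩ := hstep y hy
  have hxpos := norm_pos_iff.2 hx0
  rw [div_le_iff₀ (norm_pos_iff.2 h1)] at h2
  calc _ ≤ _ := mul_le_mul_of_nonneg_right h2 hxpos.le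
    _ = _ := by field_simp

lemma Dominates.relativeGrowthBound (h : Paired H V) (hH : ForwardInvariant A σ H)
    (hV : ForwardInvariant A σ V) {C ρ : ℝ}
    (hd : Dominates (switchedMap A σ) H V C ρ) : RelativeGrowthBound A σ h C ρ := by
  intro s t hst z hz
  obtain ⟨k, rfl⟩ := Int.le.dest hst
  obtain ⟨x, hx, y, hy, rfl⟩ := Submodule.mem_sup.1
    ((h s).sup_eq_top ▸ Submodule.mem_top : z ∈ H s ⊔ V s)
  have hy' := evolution_mem (T := switchedMap A σ) hV s k hy
  have hx' := evolution_mem (T := switchedMap A σ) hH s k hx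
  rw [h.projH_add hx hy] at hz
  rw [transitionMap_add, map_add, h.projH_add hx hy, h.projV_add hx hy, h.projH_add hx' hy',
    h.projV_add hx' hy', add_sub_cancel_left, zpow_natCast]
  obtain ⟨h1, h2⟩ := hd s k x hx hz
  refine ⟨fun _ => h1, ?_⟩
  have hxpos := norm_pos_iff.2 hz
  rw [div_le_iff₀ (norm_pos_iff.2 h1)]
  refine le_of_mul_le_mul_right ((h2 y hy).trans_eq ?_) hxpos
  field_simp

/-- If `p = 0`, every vector lies in `V`. -/
lemma existsUnique_isDominatedSplitting_zero :
    ∃! HV : SubspaceCollection n × SubspaceCollection n,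
      IsDominatedSplitting A σ 0 HV.1 HV.2 := by
  have hp : Paired (n := n) (fun _ => ⊥) (fun _ => ⊤) := fun _ => isCompl_bot_top
  refine ⟨(fun _ => ⊥, fun _ => ⊤), ⟨hp, fun _ => finrank_bot _ _, fun _ => by simp,
    fun t => by simp, fun t => le_top, 1, 1 / 2, le_rfl, by norm_num, by norm_num,
    fun s t _ x hx => absurd ?_ hx⟩, ?_⟩
  · rw [Paired.projH]
    exact Submodule.projection_apply_of_mem_right _ Submodule.mem_top
  · rintro ⟨H, V⟩ h
    refine Prod.ext (funext fun t => Submodule.finrank_eq_zero.1 (h.dim_H t)) (funext fun t => ?_)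
    exact Submodule.eq_top_of_finrank_eq (by simpa using h.dim_V t)

/-- If `p = n`, every vector lies in `H`. -/
lemma existsUnique_isDominatedSplitting_self :
    ∃! HV : SubspaceCollection n × SubspaceCollection n,
      IsDominatedSplitting A σ n HV.1 HV.2 := by
  have hp : Paired (n := n) (fun _ => ⊤) (fun _ => ⊥) := fun _ => isCompl_top_bot
  have hV : ∀ t x, hp.projV t x = 0 := fun t x => by
    rw [Paired.projV]
    exact Submodule.projection_apply_of_mem_right _ Submodule.mem_top
  refine ⟨(fun _ => ⊤, fun _ => ⊥), ⟨hp, fun _ => by simp, fun _ => by simp,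
    fun t => le_top, fun t => by simp, 1, 1 / 2, le_rfl, by norm_num, by norm_num,
    fun s t _ x hx => ⟨fun h => absurd rfl h, ?_⟩⟩, ?_⟩
  · rw [hV, hV]
    simp
  · rintro ⟨H, V⟩ h
    refine Prod.ext (funext fun t => ?_) (funext fun t => Submodule.finrank_eq_zero.1 ?_)
    · exact Submodule.eq_top_of_finrank_eq (by simpa using h.dim_H t)
    · exact (h.dim_V t).trans (Nat.sub_self n)

/-- The strict S-lemma turns the cone conditions into a uniform decrease of the quadratic forms.
Uniformity in time comes from the finiteness of the automaton and of the alphabet. -/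
lemma exists_contractingForms {Q : Type} [Finite Q] {p : ℕ} (hp0 : 0 < p) (hpn : p < n)
    {M : SwitchAutomaton Q (Fin N)} {P : Q → Matrix (Fin n) (Fin n) ℝ}
    (hP : ∀ q, HasInertia (P q) p 0 (n - p))
    (hA : ∀ q₁ s q₂, (q₁, s, q₂) ∈ M.δ →
      Matrix.toEuclideanLin (A s) '' (quadCone (P q₁) \ {0}) ⊆ interior (quadCone (P q₂)))
    {q : ℤ → Q} (hq : ∀ t : ℤ, (q t, σ t, q (t + 1)) ∈ M.δ) :
    ∃ (c : ℤ → ℝ) (B ε : ℝ), (∀ t, 0 < c t) ∧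
      ContractingForms (fun t => c t • switchedMap A σ t)
        (fun t => Matrix.toEuclideanLin (P (q t))) B ε p := by
  have hstep : ∀ τ : Q × Fin N × Q, ∃ c ε : ℝ, 0 < c ∧ 0 < ε ∧ (τ ∈ M.δ → ∀ x,
      inner ℝ (Matrix.toEuclideanLin (P τ.2.2) ((c • Matrix.toEuclideanLin (A τ.2.1)) x))
        ((c • Matrix.toEuclideanLin (A τ.2.1)) x) ≤
      inner ℝ (Matrix.toEuclideanLin (P τ.1) x) x - ε * ‖x‖ ^ 2) := by
    rintro ⟨q₁, s, q₂⟩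
    by_cases hδ : (q₁, s, q₂) ∈ M.δ
    · obtain ⟨c, ε, hc, hε, h⟩ := exists_rescaling (A := Matrix.toEuclideanLin (A s))
        (hP q₁).isSymmetric (hP q₂).isSymmetric (fun z hz hz' => by
          have h1 := hA _ _ _ hδ (Set.mem_image_of_mem _
            (⟨by rwa [quadCone_eq], hz⟩ : z ∈ quadCone (P q₁) \ {0}))
          rw [quadCone_eq] at h1
          exact form_neg_of_mem_interior (hP q₂).isSymmetric
            ((hP q₂).exists_pos (Nat.sub_pos_of_lt hpn)) h1) ((hP q₁).exists_neg hp0)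
      exact ⟨c, ε, hc, hε, fun _ => h⟩
    · exact ⟨1, 1, one_pos, one_pos, fun h => absurd h hδ⟩
  choose c ε hc hε hdrop using hstep
  have : Nonempty Q := ⟨q 0⟩
  have : Nonempty (Q × Fin N × Q) := ⟨(q 0, σ 0, q 0)⟩
  obtain ⟨τ₀, hτ₀⟩ := Finite.exists_min ε
  obtain ⟨q₀, hq₀⟩ := Finite.exists_max
    fun q => ‖(Matrix.toEuclideanLin (P q)).toContinuousLinearMap‖
  refine ⟨fun t => c (q t, σ t, q (t + 1)),
    ‖(Matrix.toEuclideanLin (P q₀)).toContinuousLinearMap‖ + ε τ₀ + 1, ε τ₀, fun t => hc _, ?_⟩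
  have hε0 := hε τ₀
  refine ⟨fun t => (hP (q t)).isSymmetric, fun t x => ?_, hε τ₀, ?_, fun t x => ?_, fun t => ?_,
    fun t => ?_⟩
  · refine ((Matrix.toEuclideanLin (P (q t))).toContinuousLinearMap.le_opNorm x).trans ?_
    gcongr
    linarith [hq₀ (q t)]
  · linarith [norm_nonneg (Matrix.toEuclideanLin (P q₀)).toContinuousLinearMap]
  · refine (hdrop _ (hq t) x).trans ?_
    gcongr
    exact hτ₀ _
  · obtain ⟨U, hU, hUx⟩ := (hP (q t)).exists_nonpos
    exact ⟨U, hU.ge, hUx⟩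
  · obtain ⟨U, hU, hUx⟩ := (hP (q t)).exists_nonneg
    refine ⟨U, ?_, hUx⟩
    rw [hU, finrank_euclideanSpace_fin]
    omega

end Splitting

theorem theorem1 (n N p : ℕ) (A : Fin N → Matrix (Fin n) (Fin n) ℝ) (L : Set (ℤ → Fin N))
    (hA : PathCompleteDominant A p L) (σ : ℤ → Fin N) (hσ : σ ∈ L) :
    ∃! HV : SubspaceCollection n × SubspaceCollection n,
      IsDominatedSplitting A σ p HV.1 HV.2 := by
  obtain ⟨Q, _, M, hM, P, hP, hcone⟩ := hA
  obtain ⟨q, hq⟩ := hM σ hσ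
  have hpn : p ≤ n := by
    have := (hP (q 0)).add_add_eq
    omega
  rcases Nat.eq_zero_or_pos p with rfl | hp0
  · exact existsUnique_isDominatedSplitting_zero
  rcases hpn.eq_or_lt with rfl | hlt
  · exact existsUnique_isDominatedSplitting_self
  obtain ⟨c, B, ε, hc, h⟩ := exists_contractingForms hp0 hlt hP hcone hq
  set T : ℤ → StateSpace n →ₗ[ℝ] StateSpace n := fun t => c t • switchedMap A σ t
  have hTA : ∀ t, T t = c t • switchedMap A σ t := fun _ => rfl
  have hAT : ∀ t, switchedMap A σ t = (c t)⁻¹ • T t := fun t => by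
    rw [hTA, smul_smul, inv_mul_cancel₀ (hc t).ne', one_smul]
  have hn : Module.finrank ℝ (StateSpace n) = n := finrank_euclideanSpace_fin
  have hpn' : p ≤ Module.finrank ℝ (StateSpace n) := hn.symm ▸ hpn
  have hinvH : ForwardInvariant A σ (boundedBackward T) :=
    map_le_of_smul hAT (map_boundedBackward_le T)
  have hinvV : ForwardInvariant A σ (boundedForward T) :=
    map_le_of_smul hAT (map_boundedForward_le T)
  have hdom := h.dominates.of_smul (fun t => inv_ne_zero (hc t).ne') hAT
  refine ⟨(boundedBackward T, boundedForward T), ⟨h.isCompl, h.finrank_boundedBackward hpn',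
    fun t => by rw [h.finrank_boundedForward hpn', hn], hinvH, hinvV, B / ε, √(1 - ε / B),
    (one_le_div h.pos).2 h.lt.le, Real.sqrt_pos.2 h.rate_pos, ?_,
    hdom.relativeGrowthBound h.isCompl hinvH hinvV⟩, ?_⟩
  · rw [Real.sqrt_lt' one_pos, one_pow]
    exact h.rate_lt_one
  · rintro ⟨H, V⟩ hHV
    obtain ⟨C, ρ, hC, hρ0, hρ1, hbound⟩ := hHV.dominated
    have hVne : ∀ t, V t ≠ ⊥ := fun t h0 => by
      have h1 : Module.finrank ℝ (V t) = n - p := hHV.dim_V t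
      rw [h0, finrank_bot] at h1
      omega
    have hd : Dominates T H V C ρ := (hbound.dominates hHV.paired hHV.invariant_H
      hHV.invariant_V hVne).of_smul (fun t => (hc t).ne') hTA
    have hdimV : ∀ t, Module.finrank ℝ (V t) = Module.finrank ℝ (StateSpace n) - p := fun t => by
      rw [hn]
      exact hHV.dim_V t
    exact Prod.ext
      (funext (h.eq_boundedBackward hpn' hHV.paired hHV.dim_H hdimV
        (map_le_of_smul hTA hHV.invariant_H) (zero_le_one.trans hC) hρ0 hρ1 hd))
      (funext (h.eq_boundedForward hpn' hHV.paired hdimV hρ0 hρ1 hd))
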